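/- Let $A=(A_1,\dots,A_n)$ be an $n$-tuple of bounded operators on a complex Hilbert space $\mathcal H$, and put $\Phi_A(X)=\sum_{i=1}^n A_iXA_i^*$. The tuple $A$ is a (row) contraction if $\Phi_A(I)=\sum_{i=1}^n A_iA_i^*\le I$. Its curvature invariant and its Euler characteristic are $$K(A)=(n-1)\lim_{m\to\infty}\frac{\operatorname{tr}\bigl(I-\Phi_A^m(I)\bigr)}{n^m},\qquad \chi(A)=(n-1)\lim_{m\to\infty}\frac{\operatorname{rk}\bigl(I-\Phi_A^m(I)\bigr)}{n^m}.$$ The pure rank of $A$ is $\operatorname{rk}\bigl(I-\sum_{i=1}^n S_iS_i^*\bigr)$, where $S=(S_1,\dots,S_n)$ is the minimal joint isometric dilation of $A$, which is unique up to unitary equivalence: the $S_i$ are isometries with pairwise orthogonal ranges on a Hilbert space $\mathcal K\supseteq\mathcal H$ with $S_i^*|_{\mathcal H}=A_i^*$ for all $i$, and $\mathcal K$ is the closed linear span of the subspaces $S_{i_1}\cdots S_{i_d}\mathcal H$ for all $d\ge 0$ and $1\le i_1,\dots,i_d\le n$. Theorem. For every $\varepsilon>0$ and all integers $k\ge1$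 and $n\ge2$, there are a complex Hilbert space and a row contraction $A=(A_1,\dots,A_n)$ on it such that the pure rank of $A$ is $k$, the limits $K(A)$ and $\chi(A)$ exist and are finite, and $$0<K(A)<\varepsilon\qquad\text{and}\qquad\chi(A)>k-\varepsilon .$$ -/

import Mathlib

open Filter Topology
open scoped ENNReal NNReal InnerProductSpace

noncomputable section

namespace RowContraction

universe u v

variable {H : Type u} [NormedAddCommGroup H] [InnerProductSpace ℂ H] [CompleteSpace H]

/-- The completely positive map `Φ_A(X) = ∑ i, A_i X A_i^*` of an `n`-tuple of operators. -/
def cpMap {n : ℕ} (A : Fin n → H →L[ℂ] H) (X : H →L[ℂ] H) : H →L[ℂ] H :=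
  ∑ i, A i * X * ContinuousLinearMap.adjoint (A i)

/-- `A` is a (row) contraction: `∑ i, A_i A_i^* ≤ I`. -/
def IsRowContraction {n : ℕ} (A : Fin n → H →L[ℂ] H) : Prop :=
  cpMap A 1 ≤ 1

/-- The operator `I - Φ_A^k(I)`. -/
def defect {n : ℕ} (A : Fin n → H →L[ℂ] H) (k : ℕ) : H →L[ℂ] H :=
  1 - (cpMap A)^[k] 1

/-- The rank of an operator, as an element of `{0, 1, 2, …, ∞}`. -/
def opRank (T : H →L[ℂ] H) : ℕ∞ :=
  Cardinal.toENat (LinearMap.rank (T : H →ₗ[ℂ] H))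

/-- The sum `∑ i, ⟨T e_i, e_i⟩ ∈ [0, ∞]` of the diagonal entries of a positive operator with
respect to an orthonormal basis `e`. -/
def diagSum {ι : Type v} (e : HilbertBasis ι ℂ H) (T : H →L[ℂ] H) : ℝ≥0∞ :=
  ∑' i, ENNReal.ofReal (T.reApplyInnerSelf (e i))

/-- The trace in `[0, ∞]` of a positive operator: the sum of its diagonal entries with respect to
an orthonormal basis. It does not depend on the basis, see `posTrace_eq_diagSum`. -/
def posTrace (T : H →L[ℂ] H) : ℝ≥0∞ :=
  diagSum (exists_hilbertBasis ℂ H).choose_spec.choose T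

theorem ofReal_norm_sq_eq_tsum {E : Type u} [NormedAddCommGroup E] [InnerProductSpace ℂ E]
    {ι : Type v} (e : HilbertBasis ι ℂ E) (x : E) :
    ENNReal.ofReal (‖x‖ ^ 2) = ∑' i, ENNReal.ofReal (‖⟪e i, x⟫_ℂ‖ ^ 2) := by
  have h := (Complex.reCLM.hasSum (e.hasSum_inner_mul_inner x x))
  have h2 : HasSum (fun i => ‖⟪e i, x⟫_ℂ‖ ^ 2) (‖x‖ ^ 2) := by
    convert h using 1
    · funext i
      rw [← inner_conj_symm x (e i)]
      simp only [Complex.reCLM_apply]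
      rw [← Complex.normSq_eq_conj_mul_self, Complex.ofReal_re, Complex.normSq_eq_norm_sq]
    · simp only [Complex.reCLM_apply]
      exact (inner_self_eq_norm_sq (𝕜 := ℂ) x).symm
  rw [← h2.tsum_eq, ENNReal.ofReal_tsum_of_nonneg (fun i => by positivity) h2.summable]

theorem posTrace_eq_diagSum {ι : Type v} (e : HilbertBasis ι ℂ H) {T : H →L[ℂ] H}
    (hT : T.IsPositive) : posTrace T = diagSum e T := by
  unfold posTrace
  generalize (exists_hilbertBasis ℂ H).choose_spec.choose = f
  have h0 : 0 ≤ T := (ContinuousLinearMap.nonneg_iff_isPositive T).2 hT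
  obtain ⟨S, hS, hSS⟩ : ∃ S : H →L[ℂ] H, ContinuousLinearMap.adjoint S = S ∧ S * S = T :=
    ⟨CFC.sqrt T, (CFC.sqrt_nonneg T).isSelfAdjoint, CFC.sqrt_mul_sqrt_self T h0⟩
  have key : ∀ x, T.reApplyInnerSelf x = ‖S x‖ ^ 2 := fun x => by
    rw [ContinuousLinearMap.reApplyInnerSelf_apply, ← hSS]
    change RCLike.re ⟪S (S x), x⟫_ℂ = _
    rw [← ContinuousLinearMap.adjoint_inner_right, hS]
    exact inner_self_eq_norm_sq (𝕜 := ℂ) (S x)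
  have sym : ∀ x y, ‖⟪x, S y⟫_ℂ‖ = ‖⟪y, S x⟫_ℂ‖ := fun x y => by
    rw [← ContinuousLinearMap.adjoint_inner_left, hS, norm_inner_symm]
  simp only [diagSum, key]
  calc _ = ∑' i, ∑' j, ENNReal.ofReal (‖⟪e j, S (f i)⟫_ℂ‖ ^ 2) :=
        tsum_congr fun i => ofReal_norm_sq_eq_tsum e _
    _ = ∑' j, ∑' i, ENNReal.ofReal (‖⟪e j, S (f i)⟫_ℂ‖ ^ 2) := ENNReal.tsum_comm
    _ = _ := tsum_congr fun j => by
        rw [ofReal_norm_sq_eq_tsum f]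
        exact tsum_congr fun i => by rw [sym]

/-- The curvature invariant `K(A) = (n - 1) lim_k tr(I - Φ_A^k(I)) / n^k` exists and equals `c`. -/
def HasCurvature {n : ℕ} (A : Fin n → H →L[ℂ] H) (c : ℝ≥0∞) : Prop :=
  Tendsto (fun k : ℕ => ((n : ℝ≥0∞) - 1) * (posTrace (defect A k) / (n : ℝ≥0∞) ^ k)) atTop (𝓝 c)

/-- The Euler characteristic `χ(A) = (n - 1) lim_k rk(I - Φ_A^k(I)) / n^k` exists and equals `c`. -/
def HasEulerChar {n : ℕ} (A : Fin n → H →L[ℂ] H) (c : ℝ≥0∞) : Prop :=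
  Tendsto (fun k : ℕ => ((n : ℝ≥0∞) - 1) * ((opRank (defect A k) : ℝ≥0∞) / (n : ℝ≥0∞) ^ k))
    atTop (𝓝 c)

/-- `S = (S_1, …, S_n)`, acting on a Hilbert space `K` which contains `H` by means of the isometry
`V`, is a minimal joint isometric dilation of `A`. -/
structure IsMinimalIsometricDilation {n : ℕ} (A : Fin n → H →L[ℂ] H)
    {K : Type v} [NormedAddCommGroup K] [InnerProductSpace ℂ K] [CompleteSpace K]
    (V : H →ₗᵢ[ℂ] K) (S : Fin n → K →L[ℂ] K) : Prop where
  /-- Every `S_i` is an isometry. -/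
  isometry : ∀ i x, ‖S i x‖ = ‖x‖
  /-- The ranges of the `S_i` are pairwise orthogonal. -/
  orthogonal_ranges : ∀ i j, i ≠ j → ∀ x y, ⟪S i x, S j y⟫_ℂ = 0
  /-- `S_i^*|_H = A_i^*`: the space `H` is co-invariant for `S_i`, and `A_i` is the compression
  of `S_i` to `H`. -/
  dilates : ∀ i x, ContinuousLinearMap.adjoint (S i) (V x) = V (ContinuousLinearMap.adjoint (A i) x)
  /-- The subspaces `S_w H`, for `w` a word in `n` letters, have closed span `K`. -/
  minimal : (Submodule.span ℂ
    {y : K | ∃ (w : List (Fin n)) (x : H), y = (w.map S).prod (V x)}).topologicalClosure = ⊤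

/-- The pure rank of `A` is `r`: a minimal isometric dilation `S` of `A` exists, and
`rk(I - ∑ i, S_i S_i^*) = r` for every such `S`. -/
def HasPureRank {n : ℕ} (A : Fin n → H →L[ℂ] H) (r : ℕ∞) : Prop :=
  (∃ (K : Type u) (_ : NormedAddCommGroup K) (_ : InnerProductSpace ℂ K) (_ : CompleteSpace K)
    (V : H →ₗᵢ[ℂ] K) (S : Fin n → K →L[ℂ] K), IsMinimalIsometricDilation A V S) ∧
  ∀ (K : Type u) [NormedAddCommGroup K] [InnerProductSpace ℂ K] [CompleteSpace K]
    (V : H →ₗᵢ[ℂ] K) (S : Fin n → K →L[ℂ] K), IsMinimalIsometricDilation A V S →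
      opRank (1 - ∑ i, S i * ContinuousLinearMap.adjoint (S i)) = r

end RowContraction

end

/-! Every natural number `x` is the child number `x % n` of exactly one vertex `x / n` (and 0 is its
own child), so the unweighted shifts `e_y ↦ e_{n * y + i}` satisfy `Φ(I) = I`. Put weight `s` on the
edges into the `k` vertices of `D = [k, 2k)`, with `s² = 1 - δ`. A path towards the ancestors meets
`D` at most once, so `I - Φ^m(I)` is `δ` times the projection onto the descendants of `D` at depth
less than `m` (`defect_weightedShift`). There are `k(1 + n + ⋯ + n^(m-1))` of them. The rank does
not see `δ`, but the trace does: `χ = k` exactly and `K = kδ`, which is as small as desired.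

The pure rank is the rank of `I - Φ(I)` (`IsMinimalIsometricDilation.opRank_eq`), which is `k`. A
minimal dilation is built explicitly by attaching a fresh `n`-ary tree at each point of `D`. -/

noncomputable section

open InnerProductSpace ContinuousLinearMap

/-! ### Hilbert bases, isometries and coordinate projections. -/

namespace HilbertBasis

variable {ι : Type*} {E F : Type*} [NormedAddCommGroup E] [InnerProductSpace ℂ E]
  [NormedAddCommGroup F] [InnerProductSpace ℂ F]

theorem inner_eq_ite [DecidableEq ι] (b : HilbertBasis ι ℂ E) (i j : ι) :
    ⟪b i, b j⟫_ℂ = if i = j then 1 else 0 :=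
  orthonormal_iff_ite.1 b.orthonormal i j

theorem ext_inner (b : HilbertBasis ι ℂ E) {x y : E} (h : ∀ i, ⟪b i, x⟫_ℂ = ⟪b i, y⟫_ℂ) :
    x = y := by
  apply b.repr.injective
  ext i
  rw [b.repr_apply_apply, b.repr_apply_apply, h]

theorem continuousLinearMap_ext (b : HilbertBasis ι ℂ E) {S T : E →L[ℂ] F}
    (h : ∀ i, S (b i) = T (b i)) : S = T := by
  refine ContinuousLinearMap.ext_on (s := Set.range b) ?_ ?_
  · rw [dense_iff_closure_eq, ← Submodule.topologicalClosure_coe, b.dense_span]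
    rfl
  · rintro _ ⟨i, rfl⟩
    exact h i

/-- The standard basis of `ℓ²(ι)`. -/
def standard (ι : Type*) : HilbertBasis ι ℂ (lp (fun _ : ι => ℂ) 2) :=
  HilbertBasis.ofRepr (LinearIsometryEquiv.refl ℂ _)

/-- The isometry that maps a Hilbert basis to a given orthonormal family. -/
def isometry [CompleteSpace F] (b : HilbertBasis ι ℂ E) {v : ι → F} (hv : Orthonormal ℂ v) :
    E →ₗᵢ[ℂ] F :=
  hv.orthogonalFamily.linearIsometry.comp b.repr.toLinearIsometry

@[simp]
theorem isometry_apply [CompleteSpace F] (b : HilbertBasis ι ℂ E) {v : ι → F}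
    (hv : Orthonormal ℂ v) (i : ι) : b.isometry hv (b i) = v i := by
  classical
  simp [isometry, b.repr_self, OrthogonalFamily.linearIsometry_apply_single]

/-- The projection onto the span of finitely many vectors of a Hilbert basis. -/
def proj (b : HilbertBasis ι ℂ E) (s : Finset ι) : E →L[ℂ] E :=
  ∑ i ∈ s, rankOne ℂ (b i) (b i)

theorem proj_apply (b : HilbertBasis ι ℂ E) (s : Finset ι) (x : E) :
    b.proj s x = ∑ i ∈ s, ⟪b i, x⟫_ℂ • b i := by
  simp [proj, rankOne_apply]

theorem proj_apply_self [DecidableEq ι] (b : HilbertBasis ι ℂ E) (s : Finset ι) (i : ι) :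
    b.proj s (b i) = if i ∈ s then b i else 0 := by
  simp [proj_apply, b.inner_eq_ite]

theorem isPositive_smul_proj [CompleteSpace E] (b : HilbertBasis ι ℂ E) (s : Finset ι) {δ : ℝ}
    (hδ : 0 ≤ δ) : ((δ : ℂ) • b.proj s).IsPositive :=
  (isPositive_sum _ fun _ _ => isPositive_rankOne_self _).smul_of_nonneg
    (by exact_mod_cast hδ)

theorem range_smul_proj (b : HilbertBasis ι ℂ E) (s : Finset ι) {δ : ℂ} (hδ : δ ≠ 0) :
    LinearMap.range ((δ • b.proj s : E →L[ℂ] E) : E →ₗ[ℂ] E) = Submodule.span ℂ (b '' s) := by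
  classical
  apply le_antisymm
  · rintro _ ⟨x, rfl⟩
    rw [coe_coe, smul_apply, proj_apply]
    exact Submodule.smul_mem _ _ (Submodule.sum_mem _ fun i hi =>
      Submodule.smul_mem _ _ (Submodule.subset_span ⟨i, hi, rfl⟩))
  · rw [Submodule.span_le]
    rintro _ ⟨i, hi, rfl⟩
    refine ⟨δ⁻¹ • b i, ?_⟩
    have hi' : i ∈ s := hi
    simp [proj_apply_self, hi', hδ]

end HilbertBasis

namespace RowContraction

universe u v

/-! ### Rank and trace of a multiple of a coordinate projection. -/

section

variable {H : Type u} [NormedAddCommGroup H] [InnerProductSpace ℂ H]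
  {ι : Type v} (b : HilbertBasis ι ℂ H) (s : Finset ι)

theorem opRank_smul_proj {δ : ℂ} (hδ : δ ≠ 0) : opRank (δ • b.proj s) = s.card := by
  rw [opRank, LinearMap.rank, b.range_smul_proj s hδ,
    toENat_rank_span_set (b.orthonormal.linearIndependent.linearIndepOn _)]
  simp

theorem posTrace_smul_proj [CompleteSpace H] {δ : ℝ} (hδ : 0 ≤ δ) :
    posTrace ((δ : ℂ) • b.proj s) = s.card * ENNReal.ofReal δ := by
  classical
  have h : ∀ i, ENNReal.ofReal (((δ : ℂ) • b.proj s).reApplyInnerSelf (b i)) =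
      if i ∈ s then ENNReal.ofReal δ else 0 := fun i => by
    rw [reApplyInnerSelf_apply, smul_apply, b.proj_apply_self]
    split_ifs
    · rw [inner_smul_left, b.inner_eq_ite]
      simp
    · simp
  rw [posTrace_eq_diagSum b (b.isPositive_smul_proj s hδ), diagSum, tsum_congr h,
    tsum_eq_sum (s := s) fun i hi => if_neg hi, Finset.sum_congr rfl fun i hi => if_pos hi]
  simp

end

/-! ### Pure rank and defect operator. -/

section PureRank

variable {H : Type u} [NormedAddCommGroup H] [InnerProductSpace ℂ H] [CompleteSpace H]
  {K : Type v} [NormedAddCommGroup K] [InnerProductSpace ℂ K] [CompleteSpace K]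
  {n : ℕ} {A : Fin n → H →L[ℂ] H} {V : H →ₗᵢ[ℂ] K} {S : Fin n → K →L[ℂ] K}

theorem adjoint_apply_of_orthogonal_ranges (hi : ∀ i x, ‖S i x‖ = ‖x‖)
    (ho : ∀ i j, i ≠ j → ∀ x y, ⟪S i x, S j y⟫_ℂ = 0) (i j : Fin n) (x : K) :
    adjoint (S i) (S j x) = if i = j then x else 0 := by
  refine ext_inner_left ℂ fun y => ?_
  rw [adjoint_inner_right]
  split_ifs with hij
  · subst hij
    exact (LinearMap.norm_map_iff_inner_map_map (S i)).1 (hi i) y x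
  · rw [ho i j hij, inner_zero_right]

namespace IsMinimalIsometricDilation

theorem one_sub_apply (hS : IsMinimalIsometricDilation A V S) (j : Fin n) (x : K) :
    (1 - ∑ i, S i * adjoint (S i)) (S j x) = 0 := by
  simp [sub_apply, adjoint_apply_of_orthogonal_ranges hS.isometry hS.orthogonal_ranges, apply_ite]

theorem adjoint_one_sub_apply (hS : IsMinimalIsometricDilation A V S) (j : Fin n) (x : K) :
    adjoint (S j) ((1 - ∑ i, S i * adjoint (S i)) x) = 0 := by
  simp [sub_apply, adjoint_apply_of_orthogonal_ranges hS.isometry hS.orthogonal_ranges]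

theorem inner_one_sub (hS : IsMinimalIsometricDilation A V S) (x y : H) :
    ⟪(1 - ∑ i, S i * adjoint (S i)) (V x), V y⟫_ℂ = ⟪defect A 1 x, y⟫_ℂ := by
  simp only [defect, cpMap, sub_apply, one_apply_eq_self, inner_sub_left,
    _root_.sum_apply, mul_apply_eq_comp, sum_inner, mul_one, V.inner_map_map,
    Function.iterate_one]
  congr 1
  refine Finset.sum_congr rfl fun i _ => ?_
  rw [← adjoint_inner_right, hS.dilates, hS.dilates, V.inner_map_map, adjoint_inner_right]

/-- With `P = I - ∑ S_i S_i^*` an orthogonal projection, `‖PVx‖² = ⟪PVx, Vx⟫`, and compressing `P`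
to `H` gives `I - Φ_A(I)`. Hence `PV` and the defect have the same kernel. -/
theorem norm_one_sub_sq (hS : IsMinimalIsometricDilation A V S) (x : H) :
    ((‖(1 - ∑ i, S i * adjoint (S i)) (V x)‖ ^ 2 : ℝ) : ℂ) = ⟪defect A 1 x, x⟫_ℂ := by
  rw [← hS.inner_one_sub, Complex.ofReal_pow]
  have h : ∀ y, ⟪(1 - ∑ i, S i * adjoint (S i)) (V x), (1 - ∑ i, S i * adjoint (S i)) y⟫_ℂ =
      ⟪(1 - ∑ i, S i * adjoint (S i)) (V x), y⟫_ℂ := fun y => by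
    have h0 : ∀ i, adjoint (S i) ((1 - ∑ i, S i * adjoint (S i)) (V x)) = 0 :=
      fun i => hS.adjoint_one_sub_apply i _
    generalize (1 - ∑ i, S i * adjoint (S i)) (V x) = z at h0 ⊢
    rw [sub_apply, inner_sub_right, one_apply_eq_self, _root_.sum_apply,
      inner_sum (𝕜 := ℂ), sub_eq_self]
    refine Finset.sum_eq_zero fun i _ => ?_
    rw [mul_apply_eq_comp, ← adjoint_inner_left, h0, inner_zero_left]
  rw [← h]
  exact (inner_self_eq_norm_sq_to_K (𝕜 := ℂ) (E := K) _).symm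

theorem one_sub_apply_eq_zero_iff (hS : IsMinimalIsometricDilation A V S) (x : H) :
    (1 - ∑ i, S i * adjoint (S i)) (V x) = 0 ↔ defect A 1 x = 0 := by
  constructor
  · intro h
    refine ext_inner_right ℂ fun y => ?_
    rw [← hS.inner_one_sub, h, inner_zero_left, inner_zero_left]
  · intro h
    have := hS.norm_one_sub_sq x
    rw [h, inner_zero_left] at this
    simpa using this

/-- The pure rank is the rank of the defect operator `I - Φ_A(I)`. -/
theorem opRank_eq (hS : IsMinimalIsometricDilation A V S)
    [FiniteDimensional ℂ (LinearMap.range (defect A 1 : H →ₗ[ℂ] H))] :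
    opRank (1 - ∑ i, S i * adjoint (S i)) = opRank (defect A 1) := by
  set P : K →L[ℂ] K := 1 - ∑ i, S i * adjoint (S i) with hP
  let Q : H →ₗ[ℂ] K := (P : K →ₗ[ℂ] K) ∘ₗ V.toLinearMap
  have hker : LinearMap.ker Q = LinearMap.ker (defect A 1 : H →ₗ[ℂ] H) := by
    ext x
    exact hS.one_sub_apply_eq_zero_iff x
  let e : LinearMap.range Q ≃ₗ[ℂ] LinearMap.range (defect A 1 : H →ₗ[ℂ] H) :=
    Q.quotKerEquivRange.symm ≪≫ₗ Submodule.quotEquivOfEq _ _ hker ≪≫ₗ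
      (defect A 1 : H →ₗ[ℂ] H).quotKerEquivRange
  have : FiniteDimensional ℂ (LinearMap.range Q) := e.symm.finiteDimensional
  have hrange : LinearMap.range (P : K →ₗ[ℂ] K) = LinearMap.range Q := by
    apply le_antisymm _ (LinearMap.range_comp_le_range _ _)
    -- Finite dimension makes the range of `PV` closed, so it is enough to control `P` on the dense
    -- span of the `S_w H`.
    have hcl : IsClosed ((LinearMap.range Q).comap (P : K →ₗ[ℂ] K) : Set K) :=
      (Submodule.closed_of_finiteDimensional (LinearMap.range Q)).preimage P.continuous
    have htop := Submodule.topologicalClosure_minimal (s := Submodule.span ℂ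
      {y : K | ∃ (w : List (Fin n)) (x : H), y = (w.map S).prod (V x)})
      (Submodule.span_le.2 ?_) hcl
    · rw [hS.minimal, top_le_iff] at htop
      exact LinearMap.range_le_iff_comap.2 htop
    · rintro _ ⟨w, x, rfl⟩
      -- `P` kills the range of every `S_i`, so only the empty word contributes.
      cases w with
      | nil => exact ⟨x, rfl⟩
      | cons i w =>
        refine ⟨0, ?_⟩
        rw [map_zero, List.map_cons, List.prod_cons]
        exact (hS.one_sub_apply i _).symm
  have hr := congrArg Cardinal.toENat e.lift_rank_eq
  rw [Cardinal.toENat_lift, Cardinal.toENat_lift] at hr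
  rw [opRank, opRank, LinearMap.rank, LinearMap.rank, hrange, hr]

end IsMinimalIsometricDilation

end PureRank
-- The weighted shifts and their minimal dilation.
section Example

/-- An index set for an orthonormal basis of the dilation space: the natural numbers are the
vertices of the forest with edges `x → n * x + i`, and a new `n`-ary tree is attached to every
point of `D`. -/
abbrev PathIndex (n : ℕ) (D : Finset ℕ) : Type := ℕ ⊕ (D × List (Fin n))

/-- The Hilbert space `ℓ²(ι)`. -/
abbrev SqSummable (ι : Type) : Type := lp (fun _ : ι => ℂ) 2

/-- The basis vector `e_x`, rotated by the matrix with first column `(s, c)` if `x ∈ D`. -/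
def rotated (n : ℕ) (D : Finset ℕ) (s c : ℝ) (x : ℕ) : SqSummable (PathIndex n D) :=
  if h : x ∈ D then
    (s : ℂ) • HilbertBasis.standard (PathIndex n D) (.inl x) +
      (c : ℂ) • HilbertBasis.standard (PathIndex n D) (.inr (⟨x, h⟩, []))
  else HilbertBasis.standard (PathIndex n D) (.inl x)

/-- The orthonormal family formed by the images of the basis vectors under the dilation. -/
def frame (n : ℕ) (D : Finset ℕ) (s c : ℝ) :
    ℕ ⊕ (D × Fin n × List (Fin n)) → SqSummable (PathIndex n D) :=
  Sum.elim (rotated n D s c)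
    fun p => HilbertBasis.standard (PathIndex n D) (.inr (p.1, p.2.1 :: p.2.2))

/-- The weight of the edge that ends in `x`. -/
def weight (D : Finset ℕ) (s : ℝ) (x : ℕ) : ℂ := if x ∈ D then s else 1

/-- The child number `i` of a vertex. -/
def child {n : ℕ} {D : Finset ℕ} (i : Fin n) : PathIndex n D → ℕ ⊕ (D × Fin n × List (Fin n)) :=
  Sum.map (fun y => n * y + i) fun p => (p.1, i, p.2)

variable {n : ℕ} {D : Finset ℕ} {s c : ℝ}

theorem orthonormal_frame (h : s ^ 2 + c ^ 2 = 1) : Orthonormal ℂ (frame n D s c) := by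
  classical
  have h' : (s : ℂ) * s + c * c = 1 := by
    rw [← sq, ← sq]
    exact_mod_cast h
  rw [orthonormal_iff_ite]
  rintro (x | ⟨d, i, w⟩) (y | ⟨d', j, w'⟩)
  · by_cases hxy : x = y
    · subst hxy
      by_cases hx : x ∈ D
      · simp only [frame, Sum.elim_inl, rotated, dif_pos hx, inner_add_left, inner_add_right,
          inner_smul_left, inner_smul_right, HilbertBasis.inner_eq_ite]
        simp [h']
      · simp only [frame, Sum.elim_inl, rotated, dif_neg hx, HilbertBasis.inner_eq_ite]
    · by_cases hx : x ∈ D <;> by_cases hy : y ∈ D <;>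
      · simp only [frame, Sum.elim_inl, rotated, hx, hy, ↓reduceDIte, inner_add_left,
          inner_add_right, inner_smul_left, inner_smul_right, HilbertBasis.inner_eq_ite]
        simp [hxy]
  · by_cases hx : x ∈ D <;>
    · simp only [frame, Sum.elim_inl, Sum.elim_inr, rotated, hx, ↓reduceDIte, inner_add_left,
        inner_smul_left, HilbertBasis.inner_eq_ite]
      simp
  · by_cases hy : y ∈ D <;>
    · simp only [frame, Sum.elim_inl, Sum.elim_inr, rotated, hy, ↓reduceDIte, inner_add_right,
        inner_smul_right, HilbertBasis.inner_eq_ite]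
      simp
  · simp [frame, HilbertBasis.inner_eq_ite]

theorem mul_add_eq_iff (i : Fin n) (x y : ℕ) : n * y + i = x ↔ x % n = i ∧ x / n = y := by
  constructor
  · rintro rfl
    rw [Nat.mul_add_mod, Nat.mod_eq_of_lt i.2, Nat.mul_add_div i.pos, Nat.div_eq_of_lt i.2]
    simp
  · rintro ⟨h, rfl⟩
    rw [← h, Nat.div_add_mod]

/-- Uniqueness of letter and parent is what makes the dilation isometric with orthogonal ranges:
distinct pairs select distinct members of the orthonormal frame. -/
theorem child_eq_iff (i j : Fin n) (a b : PathIndex n D) :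
    child i a = child j b ↔ i = j ∧ a = b := by
  constructor
  · rcases a with x | ⟨d, w⟩ <;> rcases b with y | ⟨d', w'⟩ <;> intro h
    · have h1 : n * x + i = n * y + j := by simpa [child] using h
      have h2 := (mul_add_eq_iff i _ x).1 rfl
      have h3 := (mul_add_eq_iff j _ y).1 rfl
      rw [h1] at h2
      exact ⟨Fin.ext (h2.1.symm.trans h3.1), by rw [← h2.2, h3.2]⟩
    · simp [child] at h
    · simp [child] at h
    · simp only [child, Sum.map_inr, Sum.inr.injEq, Prod.mk.injEq] at h ⊢
      tauto
  · rintro ⟨rfl, rfl⟩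
    rfl

theorem child_injective (i : Fin n) : Function.Injective (child (D := D) i) :=
  fun _ _ h => ((child_eq_iff i i _ _).1 h).2

/-- The inclusion of `ℓ²(ℕ)` in the dilation space. -/
def inclusion (n : ℕ) (D : Finset ℕ) : SqSummable ℕ →ₗᵢ[ℂ] SqSummable (PathIndex n D) :=
  (HilbertBasis.standard ℕ).isometry
    ((HilbertBasis.standard (PathIndex n D)).orthonormal.comp _ Sum.inl_injective)

/-- The isometric dilation. -/
def dilation (h : s ^ 2 + c ^ 2 = 1) (i : Fin n) :
    SqSummable (PathIndex n D) →ₗᵢ[ℂ] SqSummable (PathIndex n D) :=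
  (HilbertBasis.standard (PathIndex n D)).isometry
    ((orthonormal_frame h).comp _ (child_injective i))

/-- The weighted shifts `e_y ↦ weight (n * y + i) • e_{n * y + i}`. -/
def weightedShift (h : s ^ 2 + c ^ 2 = 1) (D : Finset ℕ) (i : Fin n) :
    SqSummable ℕ →L[ℂ] SqSummable ℕ :=
  adjoint (inclusion n D).toContinuousLinearMap ∘L
    (dilation (D := D) h i).toContinuousLinearMap ∘L (inclusion n D).toContinuousLinearMap

theorem inclusion_apply (x : ℕ) :
    inclusion n D (HilbertBasis.standard ℕ x) = HilbertBasis.standard (PathIndex n D) (.inl x) :=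
  HilbertBasis.isometry_apply _ _ x

theorem dilation_apply (h : s ^ 2 + c ^ 2 = 1) (i : Fin n) (a : PathIndex n D) :
    dilation h i (HilbertBasis.standard (PathIndex n D) a) = frame n D s c (child i a) :=
  HilbertBasis.isometry_apply _ _ a

theorem inner_inl_frame (x : ℕ) (a : ℕ ⊕ (D × Fin n × List (Fin n))) :
    ⟪HilbertBasis.standard (PathIndex n D) (.inl x), frame n D s c a⟫_ℂ =
      if a = .inl x then weight D s x else 0 := by
  classical
  rcases a with y | p
  · by_cases hy : y ∈ D
    · simp only [frame, Sum.elim_inl, rotated, dif_pos hy, inner_add_right,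
        inner_smul_right, HilbertBasis.inner_eq_ite]
      by_cases hxy : x = y
      · subst hxy
        simp [weight, hy]
      · simp [hxy, Ne.symm hxy]
    · simp only [frame, Sum.elim_inl, rotated, dif_neg hy, HilbertBasis.inner_eq_ite]
      by_cases hxy : x = y
      · subst hxy
        simp [weight, hy]
      · simp [hxy, Ne.symm hxy]
  · simp [frame, HilbertBasis.inner_eq_ite]

theorem conj_weight (x : ℕ) : (starRingEnd ℂ) (weight D s x) = weight D s x := by
  unfold weight
  split_ifs <;> simp

theorem adjoint_dilation_apply (h : s ^ 2 + c ^ 2 = 1) (i : Fin n) (x : ℕ) :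
    adjoint (dilation (D := D) h i).toContinuousLinearMap
        (HilbertBasis.standard (PathIndex n D) (.inl x)) =
      if x % n = i then weight D s x • HilbertBasis.standard (PathIndex n D) (.inl (x / n))
      else 0 := by
  classical
  refine (HilbertBasis.standard (PathIndex n D)).ext_inner fun a => ?_
  rw [adjoint_inner_right, LinearIsometry.coe_toContinuousLinearMap, dilation_apply,
    ← inner_conj_symm, inner_inl_frame]
  rcases a with y | p
  · by_cases hx : x % n = i
    · by_cases hy : x / n = y
      · rw [if_pos hx, inner_smul_right, HilbertBasis.inner_eq_ite]
        simp [child, (mul_add_eq_iff i x y).2 ⟨hx, hy⟩, hy, conj_weight]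
      · have := mt (mul_add_eq_iff i x y).1 fun h => hy h.2
        simp [child, this, hx, Ne.symm hy, HilbertBasis.inner_eq_ite]
    · have := mt (mul_add_eq_iff i x y).1 fun h => hx h.1
      simp [child, this, hx]
  · split_ifs <;> simp_all [child, HilbertBasis.inner_eq_ite]

theorem adjoint_weightedShift_apply (h : s ^ 2 + c ^ 2 = 1) (i : Fin n) (x : ℕ) :
    adjoint (weightedShift h D i) (HilbertBasis.standard ℕ x) =
      if x % n = i then weight D s x • HilbertBasis.standard ℕ (x / n) else 0 := by
  have hV : ∀ y, adjoint (inclusion n D).toContinuousLinearMap (inclusion n D y) = y := fun y =>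
    ext_inner_left ℂ fun z => by
      rw [adjoint_inner_right]
      exact (inclusion n D).inner_map_map z y
  rw [weightedShift, adjoint_comp, adjoint_comp, adjoint_adjoint, comp_apply, comp_apply,
    LinearIsometry.coe_toContinuousLinearMap, inclusion_apply, adjoint_dilation_apply]
  split_ifs
  · rw [map_smul, ← inclusion_apply, hV]
  · rw [map_zero]

theorem dilation_dilates (h : s ^ 2 + c ^ 2 = 1) (i : Fin n) (x : SqSummable ℕ) :
    adjoint (dilation (D := D) h i).toContinuousLinearMap (inclusion n D x) =
      inclusion n D (adjoint (weightedShift h D i) x) := by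
  have : adjoint (dilation (D := D) h i).toContinuousLinearMap ∘L
      (inclusion n D).toContinuousLinearMap =
      (inclusion n D).toContinuousLinearMap ∘L adjoint (weightedShift h D i) := by
    refine (HilbertBasis.standard ℕ).continuousLinearMap_ext fun x => ?_
    rw [comp_apply, comp_apply, LinearIsometry.coe_toContinuousLinearMap, inclusion_apply,
      adjoint_dilation_apply, adjoint_weightedShift_apply]
    split_ifs
    · rw [map_smul, inclusion_apply]
    · rw [map_zero]
  exact DFunLike.congr_fun this x

theorem weightedShift_apply (h : s ^ 2 + c ^ 2 = 1) (i : Fin n) (y : ℕ) :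
    weightedShift h D i (HilbertBasis.standard ℕ y) =
      weight D s (n * y + i) • HilbertBasis.standard ℕ (n * y + i) := by
  refine (HilbertBasis.standard ℕ).ext_inner fun x => ?_
  rw [← adjoint_inner_left, adjoint_weightedShift_apply, inner_smul_right,
    HilbertBasis.inner_eq_ite]
  by_cases hx : n * y + i = x
  · obtain ⟨h1, h2⟩ := (mul_add_eq_iff i x y).1 hx
    rw [if_pos h1, inner_smul_left, HilbertBasis.inner_eq_ite, conj_weight, hx, h2]
    simp
  · rw [if_neg (Ne.symm hx), mul_zero]
    split_ifs with h1
    · have : x / n ≠ y := fun h2 => hx ((mul_add_eq_iff i x y).2 ⟨h1, h2⟩)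
      rw [inner_smul_left, HilbertBasis.inner_eq_ite, if_neg this, mul_zero]
    · exact inner_zero_left _

theorem dilation_minimal (h : s ^ 2 + c ^ 2 = 1) (hc : c ≠ 0) (hn : 0 < n) :
    (Submodule.span ℂ {y | ∃ (w : List (Fin n)) (x : SqSummable ℕ),
      y = (w.map fun i => (dilation (D := D) h i).toContinuousLinearMap).prod
        (inclusion n D x)}).topologicalClosure = ⊤ := by
  set S := fun i => (dilation (D := D) h i).toContinuousLinearMap with hS
  set M := Submodule.span ℂ {y | ∃ (w : List (Fin n)) (x : SqSummable ℕ),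
    y = (w.map S).prod (inclusion n D x)} with hM
  have hinl : ∀ x, HilbertBasis.standard (PathIndex n D) (.inl x) ∈ M := fun x =>
    Submodule.subset_span ⟨[], HilbertBasis.standard ℕ x, by simp [inclusion_apply]⟩
  have hmap : ∀ i, M ≤ M.comap (S i : SqSummable (PathIndex n D) →ₗ[ℂ] _) := fun i => by
    rw [hM, Submodule.span_le]
    rintro _ ⟨w, x, rfl⟩
    exact Submodule.subset_span ⟨i :: w, x, by simp⟩
  have hinr : ∀ (w : List (Fin n)) (d : D),
      HilbertBasis.standard (PathIndex n D) (.inr (d, w)) ∈ M := fun w d => by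
    induction w with
    | nil =>
      -- The edge into `d` has image `s e_d + c e_(d,[])`; since `e_d` lies in `M` and `c ≠ 0`, so
      -- does the root of the new tree.
      have h1 := hmap ⟨d % n, Nat.mod_lt _ hn⟩ (hinl (d / n))
      have h2 : (c : ℂ) • HilbertBasis.standard (PathIndex n D) (.inr (d, [])) ∈ M := by
        rw [Submodule.mem_comap, coe_coe, hS, LinearIsometry.coe_toContinuousLinearMap,
          dilation_apply, child, Sum.map_inl, Nat.div_add_mod, frame, Sum.elim_inl, rotated,
          dif_pos d.2] at h1
        exact (Submodule.add_mem_iff_right _ (M.smul_mem _ (hinl _))).1 h1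
      exact (Submodule.smul_mem_iff _ (by exact_mod_cast hc)).1 h2
    | cons i w ih =>
      have h1 := hmap i ih
      rwa [Submodule.mem_comap, coe_coe, hS, LinearIsometry.coe_toContinuousLinearMap,
        dilation_apply] at h1
  rw [← top_le_iff, ← (HilbertBasis.standard (PathIndex n D)).dense_span]
  refine Submodule.topologicalClosure_mono (Submodule.span_le.2 ?_)
  rintro _ ⟨x | ⟨d, w⟩, rfl⟩
  exacts [hinl x, hinr w d]

theorem isMinimalIsometricDilation_dilation (h : s ^ 2 + c ^ 2 = 1) (hc : c ≠ 0) (hn : 0 < n) :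
    IsMinimalIsometricDilation (weightedShift h D) (inclusion n D)
      fun i => (dilation (D := D) h i).toContinuousLinearMap where
  isometry i x := (dilation h i).norm_map x
  orthogonal_ranges i j hij x y := by
    rw [← adjoint_inner_right]
    rw [← comp_apply]
    have : adjoint (dilation (D := D) h i).toContinuousLinearMap ∘L
        (dilation (D := D) h j).toContinuousLinearMap = 0 := by
      refine (HilbertBasis.standard (PathIndex n D)).continuousLinearMap_ext fun a => ?_
      refine (HilbertBasis.standard (PathIndex n D)).ext_inner fun b => ?_
      classical
      rw [comp_apply, adjoint_inner_right, LinearIsometry.coe_toContinuousLinearMap,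
        LinearIsometry.coe_toContinuousLinearMap, dilation_apply, dilation_apply,
        orthonormal_iff_ite.1 (orthonormal_frame h),
        if_neg fun he => hij ((child_eq_iff i j b a).1 he).1]
      simp
    rw [this, zero_apply, inner_zero_right]
  dilates := dilation_dilates h
  minimal := dilation_minimal h hc hn

/-! ### Defect operators and the count of descendants. -/

theorem cpMap_weightedShift_apply (h : s ^ 2 + c ^ 2 = 1) (hn : 0 < n)
    {X : SqSummable ℕ →L[ℂ] SqSummable ℕ} {q : ℕ → ℂ}
    (hX : ∀ x, X (HilbertBasis.standard ℕ x) = q x • HilbertBasis.standard ℕ x) (x : ℕ) :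
    cpMap (weightedShift (n := n) h D) X (HilbertBasis.standard ℕ x) =
      (weight D s x ^ 2 * q (x / n)) • HilbertBasis.standard ℕ x := by
  rw [cpMap, _root_.sum_apply, Finset.sum_eq_single (⟨x % n, Nat.mod_lt _ hn⟩ : Fin n)]
  · rw [mul_apply_eq_comp, mul_apply_eq_comp, adjoint_weightedShift_apply, if_pos rfl, map_smul,
      hX, map_smul, map_smul, weightedShift_apply, Nat.div_add_mod, smul_smul, smul_smul]
    congr 1
    ring
  · intro i _ hi
    rw [mul_apply_eq_comp, mul_apply_eq_comp, adjoint_weightedShift_apply,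
      if_neg fun h' => hi (Fin.ext h'.symm), map_zero, map_zero]
  · simp

/-- The vertices `x` such that one of `x, x / n, …, x / n ^ (m - 1)` lies in `[k, 2 * k)`. -/
def descendants (k n m : ℕ) : Finset ℕ :=
  (Finset.range m).biUnion fun j => Finset.Ico (k * n ^ j) (2 * k * n ^ j)

/-- Level `j` has `k * n ^ j` vertices, and the levels are disjoint because `2 ≤ n`. -/
theorem card_descendants {k n : ℕ} (hn : 2 ≤ n) (m : ℕ) :
    (descendants k n m).card = k * ∑ j ∈ Finset.range m, n ^ j := by
  rw [descendants, Finset.card_biUnion, Finset.mul_sum]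
  · refine Finset.sum_congr rfl fun j _ => ?_
    rw [Nat.card_Ico, mul_assoc, two_mul, Nat.add_sub_cancel]
  · have key : ∀ i j, i < j → 2 * k * n ^ i ≤ k * n ^ j := fun i j hij => by
      calc 2 * k * n ^ i = k * (n ^ i * 2) := by ring
        _ ≤ k * (n ^ i * n) := by gcongr
        _ = k * n ^ (i + 1) := by rw [pow_succ]
        _ ≤ k * n ^ j := Nat.mul_le_mul_left _ (Nat.pow_le_pow_right (by omega) hij)
    intro i _ j _ hij
    rw [Function.onFun, Finset.disjoint_left]
    intro x hi hj
    rw [Finset.mem_Ico] at hi hj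
    rcases lt_or_gt_of_ne hij with h | h
    · have := key i j h
      omega
    · have := key j i h
      omega

theorem mem_descendants_succ {k n m x : ℕ} (hn : 0 < n) :
    x ∈ descendants k n (m + 1) ↔ x ∈ Finset.Ico k (2 * k) ∨ x / n ∈ descendants k n m := by
  simp only [descendants, Finset.mem_biUnion, Finset.mem_range, Finset.mem_Ico,
    Nat.le_div_iff_mul_le hn, Nat.div_lt_iff_lt_mul hn, mul_assoc, ← pow_succ]
  constructor
  · rintro ⟨j, hj, hx⟩
    cases j with
    | zero => exact .inl (by simpa using hx)
    | succ j => exact .inr ⟨j, by omega, hx⟩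
  · rintro (hx | ⟨j, hj, hx⟩)
    · exact ⟨0, by omega, by simpa using hx⟩
    · exact ⟨j + 1, by omega, hx⟩

/-- From `x < 2k ≤ kn` the parent of `x` is below `k`, while all descendants are at least `k`. So
the factor `s²` is never picked up twice. -/
theorem div_notMem_descendants {k n m x : ℕ} (hn : 2 ≤ n) (hx : x ∈ Finset.Ico k (2 * k)) :
    x / n ∉ descendants k n m := by
  simp only [descendants, Finset.mem_biUnion, Finset.mem_Ico, not_exists, not_and]
  rw [Finset.mem_Ico] at hx
  intro j _ hj
  have h1 : x / n < k := by
    rw [Nat.div_lt_iff_lt_mul (by omega)]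
    nlinarith
  have h2 : k * 1 ≤ k * n ^ j := Nat.mul_le_mul_left _ (Nat.one_le_pow _ _ (by omega))
  omega

theorem defect_weightedShift {k : ℕ} (h : s ^ 2 + c ^ 2 = 1) (hn : 2 ≤ n) (m : ℕ) :
    defect (weightedShift (n := n) h (Finset.Ico k (2 * k))) m =
      ((c ^ 2 : ℝ) : ℂ) • (HilbertBasis.standard ℕ).proj (descendants k n m) := by
  have hq : ∀ x, (cpMap (weightedShift (n := n) h (Finset.Ico k (2 * k))))^[m] 1
      (HilbertBasis.standard ℕ x) =
        (if x ∈ descendants k n m then (s : ℂ) ^ 2 else 1) • HilbertBasis.standard ℕ x := by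
    induction m with
    | zero => simp [descendants]
    | succ m ih =>
      intro x
      rw [Function.iterate_succ_apply', cpMap_weightedShift_apply h (by omega) ih]
      congr 1
      by_cases hx : x ∈ Finset.Ico k (2 * k)
      · rw [if_neg (div_notMem_descendants hn hx),
          if_pos ((mem_descendants_succ (by omega)).2 (.inl hx)), weight, if_pos hx, mul_one]
      · simp only [mem_descendants_succ (show 0 < n by omega), hx, false_or, weight, if_false,
          one_pow, one_mul]
  refine (HilbertBasis.standard ℕ).continuousLinearMap_ext fun x => ?_
  have hc : ((c ^ 2 : ℝ) : ℂ) = 1 - (s : ℂ) ^ 2 := by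
    rw [← eq_sub_iff_add_eq'] at h
    rw [h]
    push_cast
    rfl
  rw [defect, sub_apply, hq, smul_apply, HilbertBasis.proj_apply_self, hc, one_apply_eq_self]
  split_ifs
  · rw [sub_smul, one_smul]
  · rw [one_smul, sub_self, smul_zero]

/-! ### The invariants of the example. -/

/-- Summing the geometric series turns the expression into `(1 - n⁻ᵐ) a`. The value `a = k` gives
the Euler characteristic and `a = kδ`, with `δ = c²`, the curvature. -/
theorem tendsto_geom_sum_div_pow {n : ℕ} (hn : 2 ≤ n) (a : ℝ≥0) :
    Tendsto (fun m => ((n : ℝ≥0∞) - 1) *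
      ((∑ j ∈ Finset.range m, n ^ j : ℕ) * (a : ℝ≥0∞) / (n : ℝ≥0∞) ^ m)) atTop (𝓝 a) := by
  have hn0 : (n : ℝ≥0) ≠ 0 := by positivity
  have hn1 : (1 : ℝ≥0) < n := by exact_mod_cast hn
  have hval : ∀ m, ((n : ℝ≥0∞) - 1) *
      ((∑ j ∈ Finset.range m, n ^ j : ℕ) * (a : ℝ≥0∞) / (n : ℝ≥0∞) ^ m) =
      (((1 - (n : ℝ≥0)⁻¹ ^ m) * a : ℝ≥0) : ℝ≥0∞) := fun m => by
    have hs : (((n : ℝ≥0) - 1) * ∑ j ∈ Finset.range m, (n : ℝ≥0) ^ j) = n ^ m - 1 := by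
      rw [mul_comm, geom_sum_mul_of_one_le hn1.le]
    have hv : (1 - (n : ℝ≥0)⁻¹ ^ m) * a =
        ((n : ℝ≥0) - 1) * ((∑ j ∈ Finset.range m, (n : ℝ≥0) ^ j) * a / (n : ℝ≥0) ^ m) := by
      rw [← mul_div_assoc, ← mul_assoc, hs, mul_div_right_comm, tsub_div,
        div_self (pow_ne_zero _ hn0), inv_pow, one_div]
    rw [hv]
    push_cast [ENNReal.coe_div (pow_ne_zero m hn0)]
    rfl
  simp only [hval]
  rw [ENNReal.tendsto_coe]
  have h0 : Tendsto (fun m => (n : ℝ≥0)⁻¹ ^ m) atTop (𝓝 0) :=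
    NNReal.tendsto_pow_atTop_nhds_zero_of_lt_one (inv_lt_one_of_one_lt₀ hn1)
  simpa using (tendsto_const_nhds (x := (1 : ℝ≥0)).sub h0).mul_const a

theorem hasEulerChar_weightedShift {k : ℕ} (h : s ^ 2 + c ^ 2 = 1) (hc : c ≠ 0) (hn : 2 ≤ n) :
    HasEulerChar (weightedShift (n := n) h (Finset.Ico k (2 * k))) ((k : ℝ≥0) : ℝ≥0∞) := by
  refine (tendsto_geom_sum_div_pow hn k).congr fun m => ?_
  rw [defect_weightedShift h hn, opRank_smul_proj _ _ (by exact_mod_cast pow_ne_zero 2 hc),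
    card_descendants hn, mul_comm k, ENat.toENNReal_coe, Nat.cast_mul, ENNReal.coe_natCast]

theorem hasCurvature_weightedShift {k : ℕ} (h : s ^ 2 + c ^ 2 = 1) (hn : 2 ≤ n) :
    HasCurvature (weightedShift (n := n) h (Finset.Ico k (2 * k)))
      ((k * (c ^ 2).toNNReal : ℝ≥0) : ℝ≥0∞) := by
  refine (tendsto_geom_sum_div_pow hn _).congr fun m => ?_
  rw [defect_weightedShift h hn, posTrace_smul_proj _ _ (sq_nonneg c),
    card_descendants hn, mul_comm k, ENNReal.ofReal]
  push_cast
  rw [mul_assoc]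

theorem isRowContraction_weightedShift {k : ℕ} (h : s ^ 2 + c ^ 2 = 1) (hn : 2 ≤ n) :
    IsRowContraction (weightedShift (n := n) h (Finset.Ico k (2 * k))) := by
  rw [IsRowContraction, ContinuousLinearMap.le_def]
  have h1 := defect_weightedShift (k := k) h hn 1
  rw [defect, Function.iterate_one] at h1
  rw [h1]
  exact HilbertBasis.isPositive_smul_proj _ _ (sq_nonneg c)

theorem hasPureRank_weightedShift {k : ℕ} (h : s ^ 2 + c ^ 2 = 1) (hc : c ≠ 0) (hn : 2 ≤ n) :
    HasPureRank (weightedShift (n := n) h (Finset.Ico k (2 * k))) k := by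
  have hc' : ((c ^ 2 : ℝ) : ℂ) ≠ 0 := by exact_mod_cast pow_ne_zero 2 hc
  -- The explicit dilation serves only for existence; the rank is computed for an arbitrary minimal
  -- dilation from the defect at `m = 1`.
  refine ⟨⟨_, _, _, inferInstance, _, _,
    isMinimalIsometricDilation_dilation h hc (by omega)⟩, fun K _ _ _ V S hS => ?_⟩
  have h1 := defect_weightedShift (k := k) h hn 1
  have : FiniteDimensional ℂ (LinearMap.range
      (defect (weightedShift (n := n) h (Finset.Ico k (2 * k))) 1 :
        SqSummable ℕ →ₗ[ℂ] SqSummable ℕ)) := by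
    rw [h1, HilbertBasis.range_smul_proj _ _ hc']
    exact FiniteDimensional.span_of_finite ℂ ((Finset.finite_toSet _).image _)
  rw [hS.opRank_eq, h1, opRank_smul_proj _ _ hc', card_descendants hn]
  simp

end Example

end RowContraction

end

theorem mainTheorem10 (ε : ℝ) (hε : 0 < ε) (k n : ℕ) (hk : 1 ≤ k) (hn : 2 ≤ n) :
    ∃ (H : Type) (_ : NormedAddCommGroup H) (_ : InnerProductSpace ℂ H) (_ : CompleteSpace H)
      (A : Fin n → H →L[ℂ] H) (κ χ : ℝ≥0),
      RowContraction.IsRowContraction A ∧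
      RowContraction.HasPureRank A (k : ℕ∞) ∧
      RowContraction.HasCurvature A (κ : ℝ≥0∞) ∧
      RowContraction.HasEulerChar A (χ : ℝ≥0∞) ∧
      0 < (κ : ℝ) ∧ (κ : ℝ) < ε ∧ (k : ℝ) - ε < (χ : ℝ) := by
  obtain ⟨δ, hδ0, hδ1, hδ⟩ : ∃ δ : ℝ, 0 < δ ∧ δ < 1 ∧ k * δ < ε := by
    have hk0 : (0 : ℝ) < k := by exact_mod_cast hk
    -- The bound `1 / 2` keeps `1 - δ` positive for the square root; the other one gives `kδ ≤ ε /
    -- 2`.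
    refine ⟨min (1 / 2) (ε / (2 * k)), by positivity, (min_le_left _ _).trans_lt (by norm_num), ?_⟩
    calc (k : ℝ) * min (1 / 2) (ε / (2 * k)) ≤ k * (ε / (2 * k)) := by gcongr; exact min_le_right _ _
      _ = ε / 2 := by field_simp
      _ < ε := by linarith
  have h : √(1 - δ) ^ 2 + √δ ^ 2 = 1 := by
    rw [Real.sq_sqrt (by linarith), Real.sq_sqrt hδ0.le]
    ring
  have hc : √δ ≠ 0 := (Real.sqrt_pos.2 hδ0).ne'
  have hκ : ((k * (√δ ^ 2).toNNReal : ℝ≥0) : ℝ) = k * δ := by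
    rw [Real.sq_sqrt hδ0.le]
    push_cast
    rw [Real.coe_toNNReal _ hδ0.le]
  refine ⟨_, _, _, inferInstance, RowContraction.weightedShift h (Finset.Ico k (2 * k)), _, _,
    RowContraction.isRowContraction_weightedShift h hn,
    RowContraction.hasPureRank_weightedShift h hc hn,
    RowContraction.hasCurvature_weightedShift h hn,
    RowContraction.hasEulerChar_weightedShift h hc hn, ?_, ?_, ?_⟩
  · rw [hκ]
    positivity
  · rwa [hκ]
  · rw [NNReal.coe_natCast]
    linarith
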